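/- Let $L(\mathfrak{sl}_2)=\mathbb{C}[t,t^{-1}]\otimes\mathfrak{sl}_2(\mathbb{C})$ be the $\mathfrak{sl}_2$ loop algebra, with generators $x_k^{+}=t^k\otimes e$, $x_k^{-}=t^k\otimes f$, $h_k=t^k\otimes h$ ($k\in\mathbb{Z}$), so that $[h_j,x_k^{\pm}]=\pm 2x_{j+k}^{\pm}$, $[x_j^{+},x_k^{-}]=h_{j+k}$, $[h_j,h_k]=0$ and $[x_j^{\pm},x_k^{\pm}]=0$. Let $V$ be a complex representation of $L(\mathfrak{sl}_2)$ and let $\Omega\in V$ be a highest weight vector, i.e. $\Omega\neq 0$, $x_k^{+}\Omega=0$ for all $k\in\mathbb{Z}$, and $\Omega$ is an eigenvector of $h_k$ for every $k\in\mathbb{Z}$. Assume that the subrepresentation $V_\Omega\subseteq V$ generated by $\Omega$ is finite-dimensional. Let $r\in\mathbb{Z}_{\ge 0}$ be the eigenvalue of $h_0$ on $\Omega$, let $\lambda_k$ be the eigenvalue on $\Omega$ of $\frac{(x_0^{+})^k}{k!}\,\frac{(x_1^{-})^k}{k!}$ for $0\le k\le r$, and let $$P_\Omega(u)=\sum_{k=0}^{r}\lambda_k(-u)^k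 .$$ Let $a_1,\dots,a_r\in\mathbb{C}$ be the evaluation parameters of $\Omega$ (listed with multiplicity), i.e. $P_\Omega(u)=\prod_{i=1}^{r}(1-a_iu)$. If $a_1,\dots,a_r$ are pairwise distinct, then the representation $V_\Omega$ is irreducible. -/

import Mathlib

open scoped TensorProduct

noncomputable section

namespace Sl2Loop

/-- The `sl₂` loop algebra `ℂ[t, t⁻¹] ⊗ sl₂(ℂ)`. -/
abbrev LoopSl2 : Type :=
  LieAlgebra.loopAlgebra ℂ ℤ (LieAlgebra.SpecialLinear.sl (Fin 2) ℂ)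

/-- The generator `x_k⁺ = t^k ⊗ e`. -/
def xPlus (k : ℤ) : LoopSl2 :=
  AddMonoidAlgebra.single k (1 : ℂ) ⊗ₜ[ℂ]
    LieAlgebra.SpecialLinear.single (0 : Fin 2) 1 (by decide) (1 : ℂ)

/-- The generator `x_k⁻ = t^k ⊗ f`. -/
def xMinus (k : ℤ) : LoopSl2 :=
  AddMonoidAlgebra.single k (1 : ℂ) ⊗ₜ[ℂ]
    LieAlgebra.SpecialLinear.single (1 : Fin 2) 0 (by decide) (1 : ℂ)

/-- The generator `h_k = t^k ⊗ h`. -/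
def hGen (k : ℤ) : LoopSl2 :=
  AddMonoidAlgebra.single k (1 : ℂ) ⊗ₜ[ℂ]
    LieAlgebra.SpecialLinear.singleSubSingle (0 : Fin 2) 1 (1 : ℂ)

theorem lie_xPlus_xMinus (j k : ℤ) : ⁅xPlus j, xMinus k⁆ = hGen (j + k) := by
  simp only [xPlus, xMinus, hGen, LieAlgebra.ExtendScalars.bracket_tmul,
    AddMonoidAlgebra.single_mul_single, mul_one]
  congr 1
  ext a b
  fin_cases a <;> fin_cases b <;>
    simp [Ring.lie_def, Matrix.mul_apply, Matrix.single_apply] <;> norm_num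

theorem lie_hGen_xPlus (j k : ℤ) : ⁅hGen j, xPlus k⁆ = (2 : ℂ) • xPlus (j + k) := by
  simp only [xPlus, hGen, LieAlgebra.ExtendScalars.bracket_tmul,
    AddMonoidAlgebra.single_mul_single, mul_one, ← TensorProduct.tmul_smul]
  congr 1
  ext a b
  fin_cases a <;> fin_cases b <;>
    simp [Ring.lie_def, Matrix.mul_apply, Matrix.single_apply] <;> norm_num

theorem lie_hGen_xMinus (j k : ℤ) : ⁅hGen j, xMinus k⁆ = (-2 : ℂ) • xMinus (j + k) := by
  simp only [xMinus, hGen, LieAlgebra.ExtendScalars.bracket_tmul,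
    AddMonoidAlgebra.single_mul_single, mul_one, ← TensorProduct.tmul_smul]
  congr 1
  ext a b
  fin_cases a <;> fin_cases b <;>
    simp [Ring.lie_def, Matrix.mul_apply, Matrix.single_apply] <;> norm_num

open Classical in
/-- The eigenvalue of the operator `T` on the eigenvector `Ω` (and `0` if `Ω` is not an
eigenvector of `T`). -/
def eigenvalueOn {V : Type*} [AddCommGroup V] [Module ℂ V] (T : Module.End ℂ V) (Ω : V) : ℂ :=
  if h : ∃ c : ℂ, T Ω = c • Ω then h.choose else 0

theorem eigenvalueOn_eq {V : Type*} [AddCommGroup V] [Module ℂ V] {T : Module.End ℂ V} {Ω : V}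
    (hΩ : Ω ≠ 0) {c : ℂ}
    (h : T Ω = c • Ω) : eigenvalueOn T Ω = c := by
  have hex : ∃ c : ℂ, T Ω = c • Ω := ⟨c, h⟩
  rw [eigenvalueOn, dif_pos hex]
  exact smul_left_injective ℂ hΩ (hex.choose_spec.symm.trans h)

section Representation

variable {V : Type*} [AddCommGroup V] [Module ℂ V] [LieRingModule LoopSl2 V]

/-- A highest weight vector: a nonzero vector annihilated by all `x_k⁺` that is an eigenvector of
every `h_k`, `k ∈ ℤ`. -/
structure IsHighestWeightVector (Ω : V) : Prop where
  ne_zero : Ω ≠ 0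
  xPlus_lie : ∀ k : ℤ, ⁅xPlus k, Ω⁆ = 0
  hGen_lie : ∀ k : ℤ, ∃ d : ℂ, ⁅hGen k, Ω⁆ = d • Ω

/-- The representation `V_Ω` generated by `Ω`: the smallest subrepresentation containing `Ω`. -/
abbrev generatedRep (Ω : V) : LieSubmodule ℂ LoopSl2 V :=
  LieSubmodule.lieSpan ℂ LoopSl2 {Ω}

/-- The divided power `X^(n) = X^n / n!` of the operator by which `X` acts on `V`. -/
def dividedPower (V : Type*) [AddCommGroup V] [Module ℂ V] [LieRingModule LoopSl2 V]
    [LieModule ℂ LoopSl2 V] (X : LoopSl2) (n : ℕ) : Module.End ℂ V :=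
  ((n.factorial : ℂ)⁻¹) • (LieModule.toEnd ℂ LoopSl2 V X) ^ n

open Classical in
/-- The natural number `r` with `h_0 Ω = r Ω`. (It exists if `Ω` is a highest weight vector that
generates a finite-dimensional representation; if there is none, the value is `0`.) -/
def weight (Ω : V) : ℕ :=
  if h : ∃ r : ℕ, ⁅hGen 0, Ω⁆ = (r : ℂ) • Ω then h.choose else 0

theorem weight_eq {Ω : V} (hΩ : Ω ≠ 0) {r : ℕ} (h : ⁅hGen 0, Ω⁆ = (r : ℂ) • Ω) :
    weight Ω = r := by
  have hex : ∃ r : ℕ, ⁅hGen 0, Ω⁆ = (r : ℂ) • Ω := ⟨r, h⟩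
  rw [weight, dif_pos hex]
  exact_mod_cast smul_left_injective ℂ hΩ (hex.choose_spec.symm.trans h)

variable [LieModule ℂ LoopSl2 V]

/-- `λ_k`, the eigenvalue on `Ω` of the operator `(x_0⁺)^(k) (x_1⁻)^(k)`. -/
def lam (Ω : V) (k : ℕ) : ℂ :=
  eigenvalueOn (dividedPower V (xPlus 0) k * dividedPower V (xMinus 1) k) Ω

/-- The Drinfeld polynomial `P_Ω(u) = ∑_{k=0}^r λ_k (-u)^k`. -/
def drinfeldPolynomial (Ω : V) : Polynomial ℂ :=
  ∑ k ∈ Finset.range (weight Ω + 1), Polynomial.C (lam Ω k) * (-Polynomial.X) ^ k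

/-- `a_1, …, a_r` are the evaluation parameters of `Ω`, listed with multiplicity:
`P_Ω(u) = ∏_{i=1}^r (1 - a_i u)`. -/
def IsEvaluationParameters (Ω : V) (a : Fin (weight Ω) → ℂ) : Prop :=
  drinfeldPolynomial Ω = ∏ i, (1 - Polynomial.C (a i) * Polynomial.X)

end Representation

end Sl2Loop

end

noncomputable section

namespace Sl2Loop

open LaurentPolynomial

/-- The matrix `e` of `sl₂`. -/
abbrev sl2E : LieAlgebra.SpecialLinear.sl (Fin 2) ℂ :=
  LieAlgebra.SpecialLinear.single (0 : Fin 2) 1 (by decide) (1 : ℂ)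

/-- The matrix `f` of `sl₂`. -/
abbrev sl2F : LieAlgebra.SpecialLinear.sl (Fin 2) ℂ :=
  LieAlgebra.SpecialLinear.single (1 : Fin 2) 0 (by decide) (1 : ℂ)

/-- The matrix `h` of `sl₂`. -/
abbrev sl2H : LieAlgebra.SpecialLinear.sl (Fin 2) ℂ :=
  LieAlgebra.SpecialLinear.singleSubSingle (0 : Fin 2) 1 (1 : ℂ)

theorem lie_sl2E_sl2F : ⁅sl2E, sl2F⁆ = sl2H := by
  ext a b
  fin_cases a <;> fin_cases b <;>
    simp [Ring.lie_def]

theorem lie_sl2H_sl2E : ⁅sl2H, sl2E⁆ = (2 : ℂ) • sl2E := by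
  ext a b
  fin_cases a <;> fin_cases b <;>
    simp [Ring.lie_def, Matrix.mul_apply, Matrix.single_apply]
  norm_num

theorem lie_sl2H_sl2F : ⁅sl2H, sl2F⁆ = (-2 : ℂ) • sl2F := by
  ext a b
  fin_cases a <;> fin_cases b <;>
    simp [Ring.lie_def, Matrix.mul_apply, Matrix.single_apply]
  norm_num

theorem sl2_eq_sum (A : LieAlgebra.SpecialLinear.sl (Fin 2) ℂ) :
    A = A.val 0 1 • sl2E + A.val 1 0 • sl2F + A.val 0 0 • sl2H := by
  have hA : A.val 0 0 + A.val 1 1 = 0 := by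
    have h : Matrix.trace A.val = 0 := LinearMap.mem_ker.mp A.2
    simpa [Matrix.trace, Fin.sum_univ_two] using h
  ext a b
  fin_cases a <;> fin_cases b <;>
    simp
  linear_combination hA

section Operators

variable (V : Type*) [AddCommGroup V] [Module ℂ V] [LieRingModule LoopSl2 V]
  [LieModule ℂ LoopSl2 V]

/-- The operator by which `g ⊗ A` acts, as a linear function of `g`. -/
def loopOp (A : LieAlgebra.SpecialLinear.sl (Fin 2) ℂ) : ℂ[T;T⁻¹] →ₗ[ℂ] Module.End ℂ V :=
  (LieModule.toEnd ℂ LoopSl2 V : LoopSl2 →ₗ[ℂ] Module.End ℂ V) ∘ₗ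
    (TensorProduct.mk ℂ ℂ[T;T⁻¹] (LieAlgebra.SpecialLinear.sl (Fin 2) ℂ)).flip A

/-- The action of `g ⊗ e`. -/
abbrev eOp : ℂ[T;T⁻¹] →ₗ[ℂ] Module.End ℂ V := loopOp V sl2E

/-- The action of `g ⊗ f`. -/
abbrev fOp : ℂ[T;T⁻¹] →ₗ[ℂ] Module.End ℂ V := loopOp V sl2F

/-- The action of `g ⊗ h`. -/
abbrev hOp : ℂ[T;T⁻¹] →ₗ[ℂ] Module.End ℂ V := loopOp V sl2H

variable {V}

theorem loopOp_apply (A : LieAlgebra.SpecialLinear.sl (Fin 2) ℂ) (g : ℂ[T;T⁻¹]) (v : V) :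
    loopOp V A g v = ⁅(g ⊗ₜ[ℂ] A : LoopSl2), v⁆ := rfl

theorem loopOp_eq_sum (A : LieAlgebra.SpecialLinear.sl (Fin 2) ℂ) (g : ℂ[T;T⁻¹]) :
    loopOp V A g = A.val 0 1 • eOp V g + A.val 1 0 • fOp V g + A.val 0 0 • hOp V g := by
  conv_lhs => rw [sl2_eq_sum A]
  simp [loopOp]

theorem loopOp_mul_loopOp (A B : LieAlgebra.SpecialLinear.sl (Fin 2) ℂ) (g g' : ℂ[T;T⁻¹]) :
    loopOp V A g * loopOp V B g' = loopOp V B g' * loopOp V A g + loopOp V ⁅A, B⁆ (g * g') := by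
  ext v
  have h := leibniz_lie (g ⊗ₜ[ℂ] A : LoopSl2) (g' ⊗ₜ[ℂ] B : LoopSl2) v
  rw [LieAlgebra.ExtendScalars.bracket_tmul, add_comm] at h
  exact h

theorem eOp_mul_fOp (g g' : ℂ[T;T⁻¹]) :
    eOp V g * fOp V g' = fOp V g' * eOp V g + hOp V (g * g') := by
  rw [loopOp_mul_loopOp, lie_sl2E_sl2F]

theorem hOp_mul_eOp (g g' : ℂ[T;T⁻¹]) :
    hOp V g * eOp V g' = eOp V g' * hOp V g + (2 : ℂ) • eOp V (g * g') := by
  rw [loopOp_mul_loopOp, lie_sl2H_sl2E]; simp [loopOp]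

theorem hOp_mul_fOp (g g' : ℂ[T;T⁻¹]) :
    hOp V g * fOp V g' = fOp V g' * hOp V g - (2 : ℂ) • fOp V (g * g') := by
  rw [loopOp_mul_loopOp, lie_sl2H_sl2F]; simp [loopOp, sub_eq_add_neg]

theorem loopOp_comm (A : LieAlgebra.SpecialLinear.sl (Fin 2) ℂ) (g g' : ℂ[T;T⁻¹]) :
    loopOp V A g * loopOp V A g' = loopOp V A g' * loopOp V A g := by
  rw [loopOp_mul_loopOp, lie_self]; simp [loopOp]

theorem eOp_mul_fOp_apply (g g' : ℂ[T;T⁻¹]) (v : V) :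
    eOp V g (fOp V g' v) = fOp V g' (eOp V g v) + hOp V (g * g') v :=
  LinearMap.congr_fun (eOp_mul_fOp g g') v

theorem hOp_mul_fOp_apply (g g' : ℂ[T;T⁻¹]) (v : V) :
    hOp V g (fOp V g' v) = fOp V g' (hOp V g v) - (2 : ℂ) • fOp V (g * g') v :=
  LinearMap.congr_fun (hOp_mul_fOp g g') v

theorem toEnd_xPlus (k : ℤ) : LieModule.toEnd ℂ LoopSl2 V (xPlus k) = eOp V (T k) := rfl

theorem toEnd_xMinus (k : ℤ) : LieModule.toEnd ℂ LoopSl2 V (xMinus k) = fOp V (T k) := rfl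

/-- A subspace that is stable under all `g ⊗ e`, `g ⊗ f`, `g ⊗ h` is a subrepresentation. -/
def lieSubmoduleOfStable (N : Submodule ℂ V) (he : ∀ g, ∀ v ∈ N, eOp V g v ∈ N)
    (hf : ∀ g, ∀ v ∈ N, fOp V g v ∈ N) (hh : ∀ g, ∀ v ∈ N, hOp V g v ∈ N) :
    LieSubmodule ℂ LoopSl2 V where
  __ := N
  lie_mem {x m} hm := by
    change ⁅x, m⁆ ∈ N
    replace hm : m ∈ N := hm
    induction x using TensorProduct.induction_on with
    | zero => simp
    | tmul g A =>
      rw [← loopOp_apply, loopOp_eq_sum]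
      exact N.add_mem (N.add_mem (N.smul_mem _ (he g m hm)) (N.smul_mem _ (hf g m hm)))
        (N.smul_mem _ (hh g m hm))
    | add x y hx hy => rw [add_lie]; exact N.add_mem hx hy

theorem mem_of_stable {Ω : V} (hΩ : LieSubmodule.lieSpan ℂ LoopSl2 {Ω} = ⊤) (N : Submodule ℂ V)
    (hN : Ω ∈ N) (he : ∀ g, ∀ v ∈ N, eOp V g v ∈ N)
    (hf : ∀ g, ∀ v ∈ N, fOp V g v ∈ N) (hh : ∀ g, ∀ v ∈ N, hOp V g v ∈ N) (v : V) : v ∈ N := by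
  have h : LieSubmodule.lieSpan ℂ LoopSl2 {Ω} ≤ lieSubmoduleOfStable N he hf hh :=
    LieSubmodule.lieSpan_le.mpr (Set.singleton_subset_iff.mpr hN)
  rw [hΩ] at h
  exact h (LieSubmodule.mem_top v)

theorem IsHighestWeightVector.eOp_apply {Ω : V} (hΩ : IsHighestWeightVector Ω) (g : ℂ[T;T⁻¹]) :
    eOp V g Ω = 0 := by
  induction g using LaurentPolynomial.induction_on' with
  | add p q hp hq => simp [hp, hq]
  | C_mul_T n c =>
    rw [← smul_eq_C_mul, map_smul, LinearMap.smul_apply]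
    exact (congrArg (c • ·) (hΩ.xPlus_lie n)).trans (smul_zero c)

theorem IsHighestWeightVector.exists_hOp_apply {Ω : V} (hΩ : IsHighestWeightVector Ω)
    (g : ℂ[T;T⁻¹]) : ∃ d : ℂ, hOp V g Ω = d • Ω := by
  induction g using LaurentPolynomial.induction_on' with
  | add p q hp hq =>
    obtain ⟨a, ha⟩ := hp
    obtain ⟨b, hb⟩ := hq
    exact ⟨a + b, by simp [ha, hb, add_smul]⟩
  | C_mul_T n c =>
    obtain ⟨d, hd⟩ := hΩ.hGen_lie n
    refine ⟨c * d, ?_⟩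
    rw [← smul_eq_C_mul, map_smul, LinearMap.smul_apply, mul_smul]
    exact congrArg (c • ·) hd

end Operators

open Polynomial (X)

section GarlandPolynomials

/-- The polynomials `∑ j ≤ k, (-1) ^ j * l (k - j) * X ^ j`. -/
def garlandP (l : ℕ → ℂ) : ℕ → Polynomial ℂ
  | 0 => Polynomial.C (l 0)
  | k + 1 => Polynomial.C (l (k + 1)) - X * garlandP l k

/-- The polynomials that describe the vectors `(x_0⁺)^(k) x_{j+1}⁻ (x_1⁻)^(k) Ω`. -/
def garlandW (l : ℕ → ℂ) (ψ : Polynomial ℂ →ₗ[ℂ] ℂ) : ℕ → ℕ → Polynomial ℂ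
  | 0, j => Polynomial.C (l 0) * X ^ j
  | k + 1, j =>
    X ^ j * garlandP l (k + 1) + Polynomial.C (ψ (X ^ j)) * garlandP l k - garlandW l ψ k (j + 1)

theorem garlandW_succ_add (l : ℕ → ℂ) (ψ : Polynomial ℂ →ₗ[ℂ] ℂ) (k j : ℕ) :
    garlandW l ψ (k + 1) j + X * garlandW l ψ k j =
      X ^ j * garlandP l (k + 1) + Polynomial.C (ψ (X ^ j * garlandP l k)) := by
  have hψ : ∀ (i : ℕ) (c : ℂ), ψ (X ^ i * Polynomial.C c) = c * ψ (X ^ i) := fun i c => by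
    rw [mul_comm, ← Polynomial.smul_eq_C_mul, map_smul, smul_eq_mul]
  induction k generalizing j with
  | zero =>
    simp only [garlandW, garlandP, hψ, map_mul]
    ring
  | succ k ih =>
    have h := ih (j + 1)
    have h' : ψ (X ^ j * garlandP l (k + 1)) =
        l (k + 1) * ψ (X ^ j) - ψ (X ^ (j + 1) * garlandP l k) := by
      rw [← hψ, ← map_sub]
      congr 1
      simp only [garlandP]
      ring
    have hW : ∀ n, garlandW l ψ (n + 1) j = X ^ j * garlandP l (n + 1) +
        Polynomial.C (ψ (X ^ j)) * garlandP l n - garlandW l ψ n (j + 1) := fun n => rfl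
    rw [h', hW (k + 1), hW k]
    simp only [map_sub, map_mul]
    have hP : ∀ i, garlandP l (i + 1) = Polynomial.C (l (i + 1)) - X * garlandP l i := fun i => rfl
    linear_combination -h + Polynomial.C (ψ (X ^ j)) * hP k

theorem garlandW_succ_zero {l : ℕ → ℂ} {ψ : Polynomial ℂ →ₗ[ℂ] ℂ} {k : ℕ}
    (h : garlandW l ψ k 0 = (k + 1 : ℂ) • garlandP l k)
    (hl : (k + 1 : ℂ) * l (k + 1) = ψ (garlandP l k)) :
    garlandW l ψ (k + 1) 0 = ((k + 1 : ℕ) + 1 : ℂ) • garlandP l (k + 1) := by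
  have := garlandW_succ_add l ψ k 0
  rw [h, pow_zero, one_mul, one_mul, ← hl] at this
  simp only [Polynomial.smul_eq_C_mul, map_mul, map_add, map_one, map_natCast] at this ⊢
  have hP : garlandP l (k + 1) = Polynomial.C (l (k + 1)) - X * garlandP l k := rfl
  push_cast
  linear_combination this - (k + 1 : Polynomial ℂ) * hP

theorem eval_garlandP (l : ℕ → ℂ) (k : ℕ) {x : ℂ} (hx : x ≠ 0) :
    (garlandP l k).eval x = (-x) ^ k * ∑ i ∈ Finset.range (k + 1), l i * (-x⁻¹) ^ i := by
  induction k with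
  | zero => simp [garlandP]
  | succ k ih =>
    rw [Finset.sum_range_succ, mul_add, pow_succ' (-x) k, mul_assoc, ← ih]
    have : (-x) * (-x) ^ k * (l (k + 1) * (-x⁻¹) ^ (k + 1)) = l (k + 1) := by
      rw [← pow_succ', mul_left_comm, ← mul_pow]
      simp [hx]
    rw [this]
    simp [garlandP]
    ring

end GarlandPolynomials

section PowerCommutation

variable {A : Type*} [Ring A] [Algebra ℂ A]

theorem mul_pow_succ_of_commutator {h x y : A} (hx : h * x = x * h + y) (hy : y * x = x * y)
    (k : ℕ) : h * x ^ (k + 1) = x ^ (k + 1) * h + (k + 1 : ℂ) • (y * x ^ k) := by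
  have hyk : ∀ n : ℕ, x ^ n * y = y * x ^ n := fun n =>
    ((show Commute y x from hy).pow_right n).eq.symm
  induction k with
  | zero => simp [hx]
  | succ k ih =>
    rw [pow_succ x (k + 1), ← mul_assoc, ih, add_mul, mul_assoc, hx, mul_add, smul_mul_assoc,
      mul_assoc y, ← pow_succ, hyk, ← mul_assoc]
    push_cast
    module

/-- If `[x, f] = h` and `[h, x] = 2e` commutes with `x`, then `[x ^ (k + 1), f]` is a symmetrized
product of `h` and `x ^ k`. -/
theorem pow_succ_mul_of_commutator {x f h e : A} (hf : x * f = f * x + h)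
    (hh : h * x = x * h + (2 : ℂ) • e) (he : e * x = x * e) (k : ℕ) :
    x ^ (k + 1) * f = f * x ^ (k + 1) + ((k + 1 : ℂ) / 2) • (h * x ^ k + x ^ k * h) := by
  have hk := mul_pow_succ_of_commutator hh (by simp [he])
  induction k with
  | zero =>
    simp only [zero_add, pow_one, pow_zero, hf]
    simp only [one_mul, mul_one, CharP.cast_eq_zero]
    module
  | succ k ih =>
    have h1 : x ^ (k + 1) * h = h * x ^ (k + 1) - (k + 1 : ℂ) • ((2 : ℂ) • e * x ^ k) := by
      rw [hk k]; abel
    have h2 : x * h = h * x - (2 : ℂ) • e := by rw [hh]; abel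
    rw [pow_succ' x (k + 1), mul_assoc, ih, mul_add, ← mul_assoc, hf, add_mul, mul_smul_comm,
      mul_add, ← mul_assoc x h, h2, sub_mul, mul_assoc h, ← pow_succ', ← mul_assoc x, ← pow_succ',
      h1, mul_assoc f, ← pow_succ']
    simp only [smul_mul_assoc]
    push_cast
    module

end PowerCommutation

section Garland

variable {V : Type*} [AddCommGroup V] [Module ℂ V] [LieRingModule LoopSl2 V]
  [LieModule ℂ LoopSl2 V]

theorem smul_dividedPower_succ (x : LoopSl2) (k : ℕ) :
    (k + 1 : ℂ) • dividedPower V x (k + 1) =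
      LieModule.toEnd ℂ LoopSl2 V x * dividedPower V x k := by
  have h : (k.factorial : ℂ) ≠ 0 := by exact_mod_cast k.factorial_ne_zero
  have h' : (k + 1 : ℂ) ≠ 0 := by exact_mod_cast k.succ_ne_zero
  rw [dividedPower, dividedPower, smul_smul, mul_smul_comm, ← pow_succ', Nat.factorial_succ]
  congr 1
  push_cast
  field_simp

theorem dividedPower_xPlus_mul_fOp (g : ℂ[T;T⁻¹]) (k : ℕ) :
    dividedPower V (xPlus 0) (k + 1) * fOp V g = fOp V g * dividedPower V (xPlus 0) (k + 1) +
      (1 / 2 : ℂ) • (hOp V g * dividedPower V (xPlus 0) k +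
        dividedPower V (xPlus 0) k * hOp V g) := by
  have h : (k.factorial : ℂ) ≠ 0 := by exact_mod_cast k.factorial_ne_zero
  have h' : (k + 1 : ℂ) ≠ 0 := by exact_mod_cast k.succ_ne_zero
  have key := pow_succ_mul_of_commutator (x := eOp V 1) (f := fOp V g) (h := hOp V g)
    (e := eOp V g) (by rw [eOp_mul_fOp, one_mul]) (by rw [hOp_mul_eOp, mul_one])
    (loopOp_comm _ _ _) k
  simp only [dividedPower, toEnd_xPlus, T_zero, smul_mul_assoc, mul_smul_comm, key, smul_add,
    smul_smul, Nat.factorial_succ]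
  push_cast
  congr 3 <;> field_simp

theorem hOp_mul_dividedPower_xMinus (g : ℂ[T;T⁻¹]) (k : ℕ) :
    hOp V g * dividedPower V (xMinus 1) (k + 1) = dividedPower V (xMinus 1) (k + 1) * hOp V g -
      (2 : ℂ) • (fOp V (g * T 1) * dividedPower V (xMinus 1) k) := by
  have h : (k.factorial : ℂ) ≠ 0 := by exact_mod_cast k.factorial_ne_zero
  have h' : (k + 1 : ℂ) ≠ 0 := by exact_mod_cast k.succ_ne_zero
  have key := mul_pow_succ_of_commutator (x := fOp V (T 1)) (h := hOp V g)
    (y := -((2 : ℂ) • fOp V (g * T 1))) (by rw [hOp_mul_fOp, sub_eq_add_neg])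
    (by simp [loopOp_comm _ (g * T 1)]) k
  simp only [dividedPower, toEnd_xMinus, smul_mul_assoc, mul_smul_comm, key, smul_add,
    smul_smul, Nat.factorial_succ, neg_mul, smul_neg, sub_eq_add_neg]
  push_cast
  congr 3
  field_simp

theorem IsHighestWeightVector.exists_linear_hOp {Ω : V} (hΩ : IsHighestWeightVector Ω) :
    ∃ d : ℂ[T;T⁻¹] →ₗ[ℂ] ℂ, ∀ g, hOp V g Ω = d g • Ω := by
  choose d hd using hΩ.exists_hOp_apply
  refine ⟨{ toFun := d, map_add' := fun x y => ?_, map_smul' := fun c x => ?_ }, hd⟩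
  · apply smul_left_injective ℂ hΩ.ne_zero
    simp only [add_smul, ← hd, map_add, LinearMap.add_apply]
  · apply smul_left_injective ℂ hΩ.ne_zero
    simp only [RingHom.id_apply, smul_eq_mul, mul_smul, ← hd, map_smul, LinearMap.smul_apply]

theorem lam_eq {Ω : V} (hΩ : IsHighestWeightVector Ω) {k : ℕ} {c : ℂ}
    (h : dividedPower V (xPlus 0) k (dividedPower V (xMinus 1) k Ω) = c • Ω) : lam Ω k = c :=
  eigenvalueOn_eq hΩ.ne_zero h

/-- The linear map `X ^ j ↦ x_{j+1}⁻ Ω`. -/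
def lowerMap (Ω : V) : Polynomial ℂ →ₗ[ℂ] V where
  toFun p := fOp V (T 1 * Polynomial.toLaurent p) Ω
  map_add' p q := by simp [mul_add]
  map_smul' c p := by
    rw [Polynomial.smul_eq_C_mul, map_mul Polynomial.toLaurent, Polynomial.toLaurent_C,
      mul_left_comm, ← smul_eq_C_mul]
    simp

theorem lowerMap_apply (Ω : V) (p : Polynomial ℂ) :
    lowerMap Ω p = fOp V (T 1 * Polynomial.toLaurent p) Ω := rfl

/-- Garland's formula on a highest weight vector. -/
theorem garland {Ω : V} (hΩ : IsHighestWeightVector Ω) (k : ℕ) :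
    dividedPower V (xPlus 0) k (dividedPower V (xMinus 1) (k + 1) Ω) =
      lowerMap Ω (garlandP (lam Ω) k) := by
  obtain ⟨d, hd⟩ := hΩ.exists_linear_hOp
  let toL : Polynomial ℂ →ₗ[ℂ] ℂ[T;T⁻¹] := (Polynomial.toLaurentAlg (R := ℂ)).toLinearMap
  let ψ : Polynomial ℂ →ₗ[ℂ] ℂ := d ∘ₗ LinearMap.mulLeft ℂ (T 1) ∘ₗ toL
  have hψ : ∀ p, ψ p = d (T 1 * Polynomial.toLaurent p) := fun p => rfl
  have hE : ∀ p, eOp V 1 (lowerMap Ω p) = ψ p • Ω := fun p => by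
    rw [lowerMap_apply, eOp_mul_fOp_apply, hΩ.eOp_apply, map_zero, zero_add, one_mul, hd, hψ]
  have hF : ∀ j : ℕ, fOp V (T (j + 1)) Ω = lowerMap Ω (X ^ j) := fun j => by
    rw [lowerMap_apply, Polynomial.toLaurent_X_pow, ← T_add, add_comm]
  have hT : ∀ j : ℕ, (T (j + 1) : ℂ[T;T⁻¹]) = T 1 * Polynomial.toLaurent (X ^ j) := fun j => by
    rw [Polynomial.toLaurent_X_pow, ← T_add, add_comm]
  have hH : ∀ (j : ℕ) p, hOp V (T (j + 1)) (lowerMap Ω p) =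
      ψ (X ^ j) • lowerMap Ω p - (2 : ℂ) • lowerMap Ω (X ^ (j + 1) * p) := fun j p => by
    rw [lowerMap_apply, hOp_mul_fOp_apply, hd, map_smul, hψ, ← hT, lowerMap_apply, pow_succ,
      map_mul Polynomial.toLaurent, map_mul Polynomial.toLaurent, hT j, Polynomial.toLaurent_X]
    congr 4
    ring
  suffices H : dividedPower V (xPlus 0) k (dividedPower V (xMinus 1) k Ω) = lam Ω k • Ω ∧
      dividedPower V (xPlus 0) k (dividedPower V (xMinus 1) (k + 1) Ω) =
        lowerMap Ω (garlandP (lam Ω) k) ∧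
      (∀ j : ℕ, dividedPower V (xPlus 0) k (fOp V (T (j + 1)) (dividedPower V (xMinus 1) k Ω)) =
        lowerMap Ω (garlandW (lam Ω) ψ k j)) ∧
      garlandW (lam Ω) ψ k 0 = (k + 1 : ℂ) • garlandP (lam Ω) k from H.2.1
  have step : ∀ n : ℕ, garlandW (lam Ω) ψ n 0 = (n + 1 : ℂ) • garlandP (lam Ω) n →
      (∀ j : ℕ, dividedPower V (xPlus 0) n (fOp V (T (j + 1)) (dividedPower V (xMinus 1) n Ω)) =
        lowerMap Ω (garlandW (lam Ω) ψ n j)) →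
      dividedPower V (xPlus 0) n (dividedPower V (xMinus 1) (n + 1) Ω) =
        lowerMap Ω (garlandP (lam Ω) n) := fun n hn hW => by
    have h' : (n + 1 : ℂ) ≠ 0 := by exact_mod_cast n.succ_ne_zero
    apply smul_right_injective V h'
    have h0 := hW 0
    rw [hn, map_smul] at h0
    simp only
    rw [← h0, ← map_smul, ← LinearMap.smul_apply, smul_dividedPower_succ, toEnd_xMinus]
    simp
  have dp0 : ∀ x : LoopSl2, dividedPower V x 0 = 1 := fun x => by simp [dividedPower]
  induction k with
  | zero =>
    have h0 : lam Ω 0 = 1 := lam_eq hΩ (by simp [dp0])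
    have hW0 : garlandW (lam Ω) ψ 0 0 = ((0 : ℕ) + 1 : ℂ) • garlandP (lam Ω) 0 := by
      simp [garlandW, garlandP]
    have hWj : ∀ j : ℕ,
        dividedPower V (xPlus 0) 0 (fOp V (T (j + 1)) (dividedPower V (xMinus 1) 0 Ω)) =
        lowerMap Ω (garlandW (lam Ω) ψ 0 j) := fun j => by
      simp [dp0, garlandW, h0, hF]
    exact ⟨by simp [dp0, h0], step 0 hW0 hWj, hWj, hW0⟩
  | succ k ih =>
    obtain ⟨-, hB, hZ, hW⟩ := ih
    have h' : (k + 1 : ℂ) ≠ 0 := by exact_mod_cast k.succ_ne_zero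
    have hA : dividedPower V (xPlus 0) (k + 1) (dividedPower V (xMinus 1) (k + 1) Ω) =
        ((k + 1 : ℂ)⁻¹ * ψ (garlandP (lam Ω) k)) • Ω := by
      apply smul_right_injective V h'
      simp only
      rw [← LinearMap.smul_apply, smul_dividedPower_succ, toEnd_xPlus, T_zero,
        Module.End.mul_apply, hB, hE, smul_smul, mul_inv_cancel_left₀ h']
    have hlam := lam_eq hΩ hA
    have hN : (k + 1 : ℂ) * lam Ω (k + 1) = ψ (garlandP (lam Ω) k) := by
      rw [hlam, mul_inv_cancel_left₀ h']
    rw [← hlam] at hA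
    have hWj : ∀ j : ℕ, dividedPower V (xPlus 0) (k + 1)
        (fOp V (T (j + 1)) (dividedPower V (xMinus 1) (k + 1) Ω)) =
        lowerMap Ω (garlandW (lam Ω) ψ (k + 1) j) := fun j => by
      have h1 := LinearMap.congr_fun (dividedPower_xPlus_mul_fOp (V := V) (T (j + 1)) k)
        (dividedPower V (xMinus 1) (k + 1) Ω)
      have h2 := LinearMap.congr_fun (hOp_mul_dividedPower_xMinus (V := V) (T (j + 1)) k) Ω
      have h3 := hZ (j + 1)
      simp only [Module.End.mul_apply, LinearMap.add_apply, LinearMap.smul_apply,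
        LinearMap.sub_apply] at h1 h2
      have h4 : (T (j + 1) * T 1 : ℂ[T;T⁻¹]) = T ((j + 1 : ℕ) + 1) := by
        rw [← T_add]; push_cast; rfl
      rw [h1, hA, hB, h2, h4, hd]
      simp only [map_sub, map_smul, h3, hB, hH]
      rw [hF, hT, ← hψ, garlandW, garlandP]
      simp only [mul_sub, map_sub, map_add, ← Polynomial.smul_eq_C_mul, map_smul]
      rw [mul_comm (X ^ j) (Polynomial.C _), ← Polynomial.smul_eq_C_mul, map_smul, ← mul_assoc,
        ← pow_succ]
      module
    have hW0 := garlandW_succ_zero hW hN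
    exact ⟨hA, step _ hW0 hWj, hWj, hW0⟩

end Garland

section Sl2Operators

variable {M : Type*} [AddCommGroup M] [Module ℂ M] {H E F : Module.End ℂ M}

attribute [local instance] LieRing.ofAssociativeRing LieAlgebra.ofAssociativeAlgebra

theorem isSl2Triple_of_mul (h0 : H ≠ 0) (hE : H * E = E * H + (2 : ℂ) • E)
    (hF : H * F = F * H - (2 : ℂ) • F) (hEF : E * F = F * E + H) : IsSl2Triple H E F where
  h_ne_zero := h0
  lie_e_f := by rw [Ring.lie_def, hEF, add_sub_cancel_left]
  lie_h_e_nsmul := by rw [Ring.lie_def, hE, add_sub_cancel_left, two_smul, two_nsmul]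
  lie_h_f_nsmul := by rw [Ring.lie_def, hF, sub_sub_cancel_left, two_smul, two_nsmul]

theorem hasPrimitiveVectorWith (h0 : H ≠ 0) (hE : H * E = E * H + (2 : ℂ) • E)
    (hF : H * F = F * H - (2 : ℂ) • F) (hEF : E * F = F * E + H) {w : M} (hw : w ≠ 0)
    (hEw : E w = 0) {μ : ℂ} (hHw : H w = μ • w) :
    (isSl2Triple_of_mul h0 hE hF hEF).HasPrimitiveVectorWith w μ :=
  ⟨hw, hHw, hEw⟩

theorem exists_nat_of_primitive [FiniteDimensional ℂ M] (hE : H * E = E * H + (2 : ℂ) • E)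
    (hF : H * F = F * H - (2 : ℂ) • F) (hEF : E * F = F * E + H) {w : M} (hw : w ≠ 0)
    (hEw : E w = 0) {μ : ℂ} (hHw : H w = μ • w) : ∃ n : ℕ, μ = n := by
  by_cases h0 : H = 0
  · refine ⟨0, ?_⟩
    rw [h0, LinearMap.zero_apply, eq_comm, smul_eq_zero] at hHw
    simpa using hHw.resolve_right hw
  · exact (hasPrimitiveVectorWith h0 hE hF hEF hw hEw hHw).exists_nat

theorem pow_apply_eq_zero_of_primitive [FiniteDimensional ℂ M] (hE : H * E = E * H + (2 : ℂ) • E)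
    (hF : H * F = F * H - (2 : ℂ) • F) (hEF : E * F = F * E + H) {w : M} (hw : w ≠ 0)
    (hEw : E w = 0) {n : ℕ} (hHw : H w = (n : ℂ) • w) : (F ^ (n + 1)) w = 0 := by
  by_cases h0 : H = 0
  · have hF0 : F = 0 := by simpa [h0] using hF
    simp [hF0]
  · exact (hasPrimitiveVectorWith h0 hE hF hEF hw hEw hHw).pow_toEnd_f_eq_zero_of_eq_nat rfl

/-- The Casimir operator of an `sl₂`-triple of operators. -/
def casimir (H E F : Module.End ℂ M) : Module.End ℂ M :=
  H * H + (2 : ℂ) • H + (4 : ℂ) • (F * E)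

theorem casimir_apply_of_primitive {w : M} (hEw : E w = 0) :
    casimir H E F w = H (H w) + (2 : ℂ) • H w := by
  simp [casimir, hEw]

theorem casimir_commute {G : Module.End ℂ M} {a b c : Module.End ℂ M}
    (ha : H * G = G * H + a) (hb : E * G = G * E + b) (hc : F * G = G * F + c)
    (h : H * a + a * H + (2 : ℂ) • a + (4 : ℂ) • (F * b + c * E) = 0) :
    casimir H E F * G = G * casimir H E F := by
  have h1 : H * H * G = G * H * H + a * H + H * a := by
    rw [mul_assoc, ha, mul_add, ← mul_assoc, ha, add_mul]
  have h2 : F * E * G = G * F * E + c * E + F * b := by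
    rw [mul_assoc, hb, mul_add, ← mul_assoc, hc, add_mul]
  rw [← sub_eq_zero, ← h]
  simp only [casimir, add_mul, mul_add, smul_mul_assoc, mul_smul_comm, h1, h2, ha, ← mul_assoc]
  module

/-- On a finite-dimensional module on which the Casimir operator is the scalar `m (m + 2)`, every
vector killed by `E` has weight `m`. -/
theorem apply_eq_smul_of_casimir [FiniteDimensional ℂ M] (hE : H * E = E * H + (2 : ℂ) • E)
    (hF : H * F = F * H - (2 : ℂ) • F) (hEF : E * F = F * E + H) {m : ℕ} {w : M}
    (hEw : E w = 0) (hw : casimir H E F w = ((m : ℂ) * (m + 2)) • w) : H w = (m : ℂ) • w := by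
  rw [casimir_apply_of_primitive hEw] at hw
  by_contra hne
  rw [← sub_eq_zero] at hne
  have hEH : E (H w) = 0 := by
    have := LinearMap.congr_fun hE w
    simpa [hEw] using this.symm
  obtain ⟨n, hn⟩ := exists_nat_of_primitive hE hF hEF hne (μ := -(m + 2 : ℂ))
    (by simp [hEw, hEH])
    (by
      have h2 : H (H w) = ((m : ℂ) * (m + 2)) • w - (2 : ℂ) • H w := by rw [← hw]; abel
      rw [map_sub, map_smul, h2]
      module)
  have : ((m + 2 + n : ℕ) : ℂ) = 0 := by
    push_cast
    rw [← hn]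
    ring
  have := Nat.cast_eq_zero.mp this
  omega

end Sl2Operators

section Irreducibility

variable {M : Type*} [AddCommGroup M] [Module ℂ M] [LieRingModule LoopSl2 M]
  [LieModule ℂ LoopSl2 M]

variable (M) in
/-- The ideal of all `g` such that `(g) ⊗ sl₂` acts by zero. -/
def annIdeal : Ideal ℂ[T;T⁻¹] where
  carrier := {g | ∀ c A, loopOp M A (c * g) = 0}
  add_mem' {g g'} hg hg' c A := by rw [mul_add, map_add, hg, hg', add_zero]
  zero_mem' c A := by rw [mul_zero, map_zero]
  smul_mem' c g hg c' A := by rw [smul_eq_mul, ← mul_assoc]; exact hg _ _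

theorem loopOp_eq_zero_of_mem_annIdeal {g : ℂ[T;T⁻¹]} (hg : g ∈ annIdeal M)
    (A : LieAlgebra.SpecialLinear.sl (Fin 2) ℂ) : loopOp M A g = 0 := by
  simpa using hg 1 A

theorem loopOp_eq_of_sub_mem {g g' : ℂ[T;T⁻¹]} (h : g - g' ∈ annIdeal M)
    (A : LieAlgebra.SpecialLinear.sl (Fin 2) ℂ) : loopOp M A g = loopOp M A g' := by
  rw [← sub_eq_zero, ← map_sub]
  exact loopOp_eq_zero_of_mem_annIdeal h A

theorem mem_annIdeal_of_fOp_eq_zero {Ω : M} (hΩ : IsHighestWeightVector Ω)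
    (hgen : LieSubmodule.lieSpan ℂ LoopSl2 {Ω} = ⊤) {g : ℂ[T;T⁻¹]} (hg : fOp M g Ω = 0) :
    g ∈ annIdeal M := by
  have hf : ∀ c, fOp M (c * g) Ω = 0 := fun c => by
    have h := hOp_mul_fOp_apply c g Ω
    obtain ⟨d, hd⟩ := hΩ.exists_hOp_apply c
    rw [hg, hd, map_smul, hg, map_zero, smul_zero, zero_sub, eq_comm, neg_eq_zero] at h
    exact (smul_eq_zero.mp h).resolve_left two_ne_zero
  have hh : ∀ c, hOp M (c * g) Ω = 0 := fun c => by
    have h := eOp_mul_fOp_apply 1 (c * g) Ω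
    rwa [hf, hΩ.eOp_apply, map_zero, map_zero, zero_add, one_mul, eq_comm] at h
  let N : Submodule ℂ M := ⨅ (c : ℂ[T;T⁻¹]) (A : LieAlgebra.SpecialLinear.sl (Fin 2) ℂ),
    LinearMap.ker (loopOp M A (c * g))
  have hN : ∀ v, v ∈ N ↔ ∀ c A, loopOp M A (c * g) v = 0 := fun v => by
    simp [N, Submodule.mem_iInf]
  have stable : ∀ B g', ∀ v ∈ N, loopOp M B g' v ∈ N := fun B g' v hv => by
    rw [hN] at hv ⊢
    intro c A
    have h := LinearMap.congr_fun (loopOp_mul_loopOp (V := M) A B (c * g) g') v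
    simp only [Module.End.mul_apply, LinearMap.add_apply] at h
    rw [h, hv, map_zero, zero_add, mul_right_comm, hv]
  intro c A
  ext v
  refine (hN v).mp (mem_of_stable hgen N ((hN Ω).mpr fun c A => ?_) (stable _) (stable _)
    (stable _) v) c A
  rw [loopOp_eq_sum]
  simp [hf, hh, hΩ.eOp_apply]

section Idempotent

variable {ε : ℂ[T;T⁻¹]} {χ : ℂ[T;T⁻¹] → ℂ}

theorem casimir_apply_eq_smul {Ω : M} (hΩ : IsHighestWeightVector Ω)
    (hgen : LieSubmodule.lieSpan ℂ LoopSl2 {Ω} = ⊤)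
    (hχ : ∀ g, ε * g - χ g • ε ∈ annIdeal M) (hε : ε * ε - ε ∈ annIdeal M) {m : ℂ}
    (hm : hOp M ε Ω = m • Ω) (v : M) :
    casimir (hOp M ε) (eOp M ε) (fOp M ε) v = (m * (m + 2)) • v := by
  have hop : ∀ A g, loopOp M A (ε * g) = χ g • loopOp M A ε := fun A g => by
    rw [loopOp_eq_of_sub_mem (hχ g), map_smul]
  have hop1 : ∀ A, loopOp M A (ε * ε) = loopOp M A ε := loopOp_eq_of_sub_mem hε
  set C := casimir (hOp M ε) (eOp M ε) (fOp M ε) with hC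
  have he : ∀ g, C * eOp M g = eOp M g * C := fun g => by
    refine casimir_commute (a := (2 * χ g) • eOp M ε) (b := 0) (c := -(χ g • hOp M ε)) ?_ ?_ ?_ ?_
    · rw [hOp_mul_eOp, hop, smul_smul]
    · rw [add_zero, loopOp_comm]
    · rw [eOp_mul_fOp, mul_comm, hop]; abel
    · simp only [mul_smul_comm, smul_mul_assoc, hOp_mul_eOp, hop1, mul_zero, neg_mul]
      module
  have hf : ∀ g, C * fOp M g = fOp M g * C := fun g => by
    refine casimir_commute (a := -((2 * χ g) • fOp M ε)) (b := χ g • hOp M ε) (c := 0) ?_ ?_ ?_ ?_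
    · rw [hOp_mul_fOp, hop, smul_smul]; abel
    · rw [eOp_mul_fOp, hop]
    · rw [add_zero, loopOp_comm]
    · simp only [mul_smul_comm, smul_mul_assoc, hOp_mul_fOp, hop1, zero_mul, neg_mul, mul_neg]
      module
  have hh : ∀ g, C * hOp M g = hOp M g * C := fun g => by
    refine casimir_commute (a := 0) (b := -((2 * χ g) • eOp M ε)) (c := (2 * χ g) • fOp M ε)
      ?_ ?_ ?_ ?_
    · rw [add_zero, loopOp_comm]
    · rw [hOp_mul_eOp, mul_comm g, hop, smul_smul]; abel
    · rw [hOp_mul_fOp, mul_comm g, hop, smul_smul]; abel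
    · simp only [mul_smul_comm, smul_mul_assoc, zero_mul, mul_zero, mul_neg]
      module
  have stable : ∀ {S : Module.End ℂ M}, C * S = S * C →
      ∀ v ∈ C.eigenspace (m * (m + 2)), S v ∈ C.eigenspace (m * (m + 2)) := fun {S} hS v hv => by
    rw [Module.End.mem_eigenspace_iff] at hv ⊢
    rw [← Module.End.mul_apply, hS, Module.End.mul_apply, hv, map_smul]
  refine Module.End.mem_eigenspace_iff.mp (mem_of_stable hgen _ ?_ (fun g => stable (he g))
    (fun g => stable (hf g)) (fun g => stable (hh g)) v)
  rw [Module.End.mem_eigenspace_iff, hC, casimir_apply_of_primitive (hΩ.eOp_apply ε), hm, map_smul,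
    hm]
  module

theorem hOp_apply_of_primitive [FiniteDimensional ℂ M] {Ω : M} (hΩ : IsHighestWeightVector Ω)
    (hgen : LieSubmodule.lieSpan ℂ LoopSl2 {Ω} = ⊤)
    (hχ : ∀ g, ε * g - χ g • ε ∈ annIdeal M) (hε : ε * ε - ε ∈ annIdeal M) {m : ℂ}
    (hm : hOp M ε Ω = m • Ω) {w : M} (hw : eOp M ε w = 0) : hOp M ε w = m • w := by
  have hop1 : ∀ A, loopOp M A (ε * ε) = loopOp M A ε := loopOp_eq_of_sub_mem hε
  have hE : hOp M ε * eOp M ε = eOp M ε * hOp M ε + (2 : ℂ) • eOp M ε := by rw [hOp_mul_eOp, hop1]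
  have hF : hOp M ε * fOp M ε = fOp M ε * hOp M ε - (2 : ℂ) • fOp M ε := by rw [hOp_mul_fOp, hop1]
  have hEF : eOp M ε * fOp M ε = fOp M ε * eOp M ε + hOp M ε := by rw [eOp_mul_fOp, hop1]
  obtain ⟨n, rfl⟩ := exists_nat_of_primitive hE hF hEF hΩ.ne_zero (hΩ.eOp_apply ε) hm
  exact apply_eq_smul_of_casimir hE hF hEF hw (casimir_apply_eq_smul hΩ hgen hχ hε hm w)

end Idempotent

/-- The subspace spanned by the vectors `x_{k_1}⁻ ⋯ x_{k_j}⁻ Ω` with `j ≤ n`. -/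
def lowerFiltration (Ω : M) : ℕ → Submodule ℂ M
  | 0 => Submodule.span ℂ {Ω}
  | n + 1 => lowerFiltration Ω n ⊔ ⨆ g, (lowerFiltration Ω n).map (fOp M g)

section Filtration

variable {Ω : M}

theorem lowerFiltration_le_succ (n : ℕ) : lowerFiltration Ω n ≤ lowerFiltration Ω (n + 1) :=
  le_sup_left

theorem fOp_mem_lowerFiltration (g : ℂ[T;T⁻¹]) {n : ℕ} {v : M} (hv : v ∈ lowerFiltration Ω n) :
    fOp M g v ∈ lowerFiltration Ω (n + 1) :=
  (le_iSup (fun g => (lowerFiltration Ω n).map (fOp M g)) g).trans le_sup_right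
    (Submodule.mem_map_of_mem hv)

theorem lowerFiltration_succ_le {n : ℕ} {N : Submodule ℂ M} (h : lowerFiltration Ω n ≤ N)
    (hf : ∀ g, ∀ v ∈ lowerFiltration Ω n, fOp M g v ∈ N) : lowerFiltration Ω (n + 1) ≤ N :=
  sup_le h (iSup_le fun g => Submodule.map_le_iff_le_comap.mpr (hf g))

theorem hOp_mem_lowerFiltration (hΩ : IsHighestWeightVector Ω) (n : ℕ) (g : ℂ[T;T⁻¹]) {v : M}
    (hv : v ∈ lowerFiltration Ω n) : hOp M g v ∈ lowerFiltration Ω n := by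
  induction n generalizing g v with
  | zero =>
    obtain ⟨c, rfl⟩ := Submodule.mem_span_singleton.mp hv
    obtain ⟨d, hd⟩ := hΩ.exists_hOp_apply g
    rw [map_smul, hd]
    exact Submodule.smul_mem _ _ (Submodule.smul_mem _ _ (Submodule.mem_span_singleton_self Ω))
  | succ n ih =>
    refine lowerFiltration_succ_le (N := (lowerFiltration Ω (n + 1)).comap (hOp M g))
      (fun w hw => lowerFiltration_le_succ n (ih g hw)) (fun g' w hw => ?_) hv
    rw [Submodule.mem_comap, hOp_mul_fOp_apply]
    exact Submodule.sub_mem _ (fOp_mem_lowerFiltration g' (ih g hw))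
      (Submodule.smul_mem _ _ (fOp_mem_lowerFiltration _ hw))

theorem eOp_apply_of_mem_lowerFiltration_zero (hΩ : IsHighestWeightVector Ω) (g : ℂ[T;T⁻¹])
    {v : M} (hv : v ∈ lowerFiltration Ω 0) : eOp M g v = 0 := by
  obtain ⟨c, rfl⟩ := Submodule.mem_span_singleton.mp hv
  rw [map_smul, hΩ.eOp_apply, smul_zero]

theorem eOp_mem_lowerFiltration (hΩ : IsHighestWeightVector Ω) (n : ℕ) (g : ℂ[T;T⁻¹]) {v : M}
    (hv : v ∈ lowerFiltration Ω (n + 1)) : eOp M g v ∈ lowerFiltration Ω n := by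
  induction n generalizing g v with
  | zero =>
    refine lowerFiltration_succ_le (N := (lowerFiltration Ω 0).comap (eOp M g))
      (fun w hw => ?_) (fun g' w hw => ?_) hv
    · rw [Submodule.mem_comap, eOp_apply_of_mem_lowerFiltration_zero hΩ g hw]
      exact Submodule.zero_mem _
    · rw [Submodule.mem_comap, eOp_mul_fOp_apply, eOp_apply_of_mem_lowerFiltration_zero hΩ g hw,
        map_zero, zero_add]
      exact hOp_mem_lowerFiltration hΩ 0 _ hw
  | succ n ih =>
    refine lowerFiltration_succ_le (N := (lowerFiltration Ω (n + 1)).comap (eOp M g))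
      (fun w hw => lowerFiltration_le_succ n (ih g hw)) (fun g' w hw => ?_) hv
    rw [Submodule.mem_comap, eOp_mul_fOp_apply]
    exact Submodule.add_mem _ (fOp_mem_lowerFiltration g' (ih g hw))
      (hOp_mem_lowerFiltration hΩ _ _ hw)

theorem hOp_one_sub_mem_lowerFiltration (hΩ : IsHighestWeightVector Ω) {r : ℂ}
    (hr : hOp M 1 Ω = r • Ω) (n : ℕ) {v : M} (hv : v ∈ lowerFiltration Ω (n + 1)) :
    hOp M 1 v - (r - 2 * (n + 1)) • v ∈ lowerFiltration Ω n := by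
  have h0 : ∀ w ∈ lowerFiltration Ω 0, hOp M 1 w = r • w := fun w hw => by
    obtain ⟨c, rfl⟩ := Submodule.mem_span_singleton.mp hw
    rw [map_smul, hr, smul_comm]
  have key : ∀ (s : ℂ) (g : ℂ[T;T⁻¹]) (w : M), hOp M 1 (fOp M g w) - (s - 2) • fOp M g w =
      fOp M g (hOp M 1 w - s • w) := fun s g w => by
    rw [hOp_mul_fOp_apply, one_mul, map_sub, map_smul]
    module
  let D : ℂ → Module.End ℂ M := fun s => hOp M 1 - s • 1
  have hD : ∀ s w, D s w = hOp M 1 w - s • w := fun s w => rfl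
  have low : ∀ (n : ℕ) (s : ℂ), ∀ w ∈ lowerFiltration Ω n, D s w ∈ lowerFiltration Ω n :=
    fun n s w hw => Submodule.sub_mem _ (hOp_mem_lowerFiltration hΩ _ _ hw)
      (Submodule.smul_mem _ _ hw)
  rw [← hD]
  induction n generalizing v with
  | zero =>
    refine lowerFiltration_succ_le (N := (lowerFiltration Ω 0).comap (D _)) (low 0 _)
      (fun g w hw => ?_) hv
    rw [Submodule.mem_comap, hD, show (r - 2 * ((0 : ℕ) + 1) : ℂ) = r - 2 by simp, key, h0 w hw,
      sub_self, map_zero]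
    exact Submodule.zero_mem _
  | succ n ih =>
    refine lowerFiltration_succ_le (N := (lowerFiltration Ω (n + 1)).comap (D _)) (low (n + 1) _)
      (fun g w hw => ?_) hv
    rw [Submodule.mem_comap, hD,
      show (r - 2 * ((n + 1 : ℕ) + 1) : ℂ) = (r - 2 * (n + 1)) - 2 by push_cast; ring, key]
    exact fOp_mem_lowerFiltration g (ih hw)

theorem exists_mem_lowerFiltration (hΩ : IsHighestWeightVector Ω)
    (hgen : LieSubmodule.lieSpan ℂ LoopSl2 {Ω} = ⊤) (v : M) : ∃ n, v ∈ lowerFiltration Ω n := by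
  have hdir : Directed (· ≤ ·) (lowerFiltration Ω) :=
    (monotone_nat_of_le_succ lowerFiltration_le_succ).directed_le
  have hmem : ∀ w, w ∈ ⨆ n, lowerFiltration Ω n ↔ ∃ n, w ∈ lowerFiltration Ω n := fun w =>
    Submodule.mem_iSup_of_directed _ hdir
  rw [← hmem]
  refine mem_of_stable hgen _ ?_ (fun g w hw => ?_) (fun g w hw => ?_) (fun g w hw => ?_) v
  · exact (hmem _).mpr ⟨0, Submodule.mem_span_singleton_self Ω⟩
  · obtain ⟨n, hn⟩ := (hmem _).mp hw
    exact (hmem _).mpr ⟨n, eOp_mem_lowerFiltration hΩ n g (lowerFiltration_le_succ n hn)⟩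
  · obtain ⟨n, hn⟩ := (hmem _).mp hw
    exact (hmem _).mpr ⟨n + 1, fOp_mem_lowerFiltration g hn⟩
  · obtain ⟨n, hn⟩ := (hmem _).mp hw
    exact (hmem _).mpr ⟨n, hOp_mem_lowerFiltration hΩ n g hn⟩

/-- A representation generated by a highest weight vector `Ω` is irreducible if all vectors killed
by the `x_k⁺` have the same `h_0`-weight as `Ω`. -/
theorem isIrreducible_of_primitive (hΩ : IsHighestWeightVector Ω)
    (hgen : LieSubmodule.lieSpan ℂ LoopSl2 {Ω} = ⊤) {r : ℂ} (hr : hOp M 1 Ω = r • Ω)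
    (hprim : ∀ w, (∀ g, eOp M g w = 0) → hOp M 1 w = r • w) :
    LieModule.IsIrreducible ℂ LoopSl2 M := by
  classical
  have : Nontrivial M := ⟨Ω, 0, hΩ.ne_zero⟩
  refine LieModule.IsIrreducible.mk fun N hN => ?_
  obtain ⟨v, hvN, hv⟩ : ∃ v ∈ N, v ≠ 0 := by
    by_contra! h
    exact hN ((LieSubmodule.eq_bot_iff N).mpr h)
  have hex : ∃ n, ∃ w ∈ N, w ≠ 0 ∧ w ∈ lowerFiltration Ω n := by
    obtain ⟨n, hn⟩ := exists_mem_lowerFiltration hΩ hgen v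
    exact ⟨n, v, hvN, hv, hn⟩
  obtain ⟨w, hwN, hw, hwn⟩ := Nat.find_spec hex
  have hmin : ∀ k < Nat.find hex, ∀ u ∈ N, u ∈ lowerFiltration Ω k → u = 0 := by
    intro k hk u hu huk
    by_contra h
    exact Nat.find_min hex hk ⟨u, hu, h, huk⟩
  rcases hn : Nat.find hex with _ | k
  · rw [hn] at hwn
    obtain ⟨c, rfl⟩ := Submodule.mem_span_singleton.mp hwn
    have hc : c ≠ 0 := fun h => hw (by rw [h, zero_smul])
    have hΩN : Ω ∈ N := by
      have := N.smul_mem c⁻¹ hwN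
      rwa [smul_smul, inv_mul_cancel₀ hc, one_smul] at this
    rw [eq_top_iff, ← hgen]
    exact LieSubmodule.lieSpan_le.mpr (Set.singleton_subset_iff.mpr hΩN)
  · rw [hn] at hwn hmin
    exfalso
    have hpw : hOp M 1 w = r • w := hprim w fun g =>
      hmin k k.lt_succ_self _ (N.lie_mem hwN) (eOp_mem_lowerFiltration hΩ k g hwn)
    have h := hOp_one_sub_mem_lowerFiltration hΩ hr k hwn
    rw [hpw, ← sub_smul, sub_sub_cancel] at h
    have hk : (2 * (k + 1) : ℂ) ≠ 0 := mul_ne_zero two_ne_zero (by exact_mod_cast k.succ_ne_zero)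
    exact hw (hmin k k.lt_succ_self w hwN ((Submodule.smul_mem_iff _ hk).mp h))

end Filtration

end Irreducibility

theorem sub_smul_mem_of_X_sub_C_mul_mem {I : Ideal ℂ[T;T⁻¹]} {ε : ℂ[T;T⁻¹]} {a : ℂ}
    (h : Polynomial.toLaurent (X - Polynomial.C a) * ε ∈ I) (p : Polynomial ℂ) :
    ε * Polynomial.toLaurent p - p.eval a • ε ∈ I := by
  obtain ⟨q, hq⟩ := Polynomial.X_sub_C_dvd_sub_C_eval (a := a) (p := p)
  have hp : p = (X - Polynomial.C a) * q + Polynomial.C (p.eval a) := by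
    rw [← hq, sub_add_cancel]
  have : ε * Polynomial.toLaurent p - p.eval a • ε =
      Polynomial.toLaurent q * (Polynomial.toLaurent (X - Polynomial.C a) * ε) := by
    conv_lhs => rw [hp]
    rw [map_add, map_mul, Polynomial.toLaurent_C, smul_eq_C_mul]
    simp only [Polynomial.eval_add, Polynomial.eval_mul, Polynomial.eval_sub, Polynomial.eval_X,
      Polynomial.eval_C, sub_self, zero_mul, zero_add]
    ring
  rw [this]
  exact I.mul_mem_left _ h

theorem exists_sub_smul_mem_of_X_sub_C_mul_mem {I : Ideal ℂ[T;T⁻¹]} {ε : ℂ[T;T⁻¹]} {a : ℂ}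
    (ha : a ≠ 0) (h : Polynomial.toLaurent (X - Polynomial.C a) * ε ∈ I) (g : ℂ[T;T⁻¹]) :
    ∃ c : ℂ, ε * g - c • ε ∈ I := by
  obtain ⟨n, p, hp⟩ := exists_T_pow g
  have h1 := sub_smul_mem_of_X_sub_C_mul_mem h p
  have h2 := sub_smul_mem_of_X_sub_C_mul_mem h (X ^ n)
  rw [Polynomial.toLaurent_X_pow, Polynomial.eval_pow, Polynomial.eval_X] at h2
  refine ⟨(a ^ n)⁻¹ * p.eval a, ?_⟩
  have hT : (T n * T (-n) : ℂ[T;T⁻¹]) = 1 := by rw [← T_add, add_neg_cancel, T_zero]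
  have hC : LaurentPolynomial.C ((a ^ n)⁻¹) * LaurentPolynomial.C (a ^ n) = 1 := by
    rw [← map_mul, inv_mul_cancel₀ (pow_ne_zero n ha), map_one]
  have : ε * g - ((a ^ n)⁻¹ * p.eval a) • ε =
      T (-n) * (ε * Polynomial.toLaurent p - p.eval a • ε) -
      LaurentPolynomial.C ((a ^ n)⁻¹ * p.eval a) * T (-n) * (ε * T n - a ^ n • ε) := by
    rw [hp]
    simp only [smul_eq_C_mul, map_mul]
    linear_combination (-ε * g + LaurentPolynomial.C ((a ^ n)⁻¹) *
      LaurentPolynomial.C (p.eval a) * ε) * hT -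
      LaurentPolynomial.C (p.eval a) * T (-n) * ε * hC
  rw [this]
  exact I.sub_mem (I.mul_mem_left _ h1) (I.mul_mem_left _ h2)

theorem prod_X_sub_C_dvd_X_sub_C_mul_basis {ι : Type*} [DecidableEq ι] {S : Finset ι} (a : ι → ℂ)
    {i : ι} (hi : i ∈ S) :
    ∏ j ∈ S, (X - Polynomial.C (a j)) ∣ (X - Polynomial.C (a i)) * Lagrange.basis S a i := by
  rw [← Finset.mul_prod_erase S _ hi, Lagrange.basis]
  exact mul_dvd_mul_left _ (Finset.prod_dvd_prod_of_dvd _ _ fun j _ => Dvd.intro_left _ rfl)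

/-- A finite-dimensional representation generated by a highest weight vector on which the ideal of
finitely many distinct nonzero points acts by zero is irreducible. -/
theorem isIrreducible_of_prod_mem_annIdeal {M : Type*} [AddCommGroup M] [Module ℂ M]
    [LieRingModule LoopSl2 M] [LieModule ℂ LoopSl2 M] [FiniteDimensional ℂ M] {Ω : M}
    (hΩ : IsHighestWeightVector Ω) (hgen : LieSubmodule.lieSpan ℂ LoopSl2 {Ω} = ⊤)
    {ι : Type*} [DecidableEq ι] {S : Finset ι} {a : ι → ℂ} (hinj : Set.InjOn a S)
    (ha : ∀ i ∈ S, a i ≠ 0)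
    (hS : Polynomial.toLaurent (∏ i ∈ S, (X - Polynomial.C (a i))) ∈ annIdeal M) :
    LieModule.IsIrreducible ℂ LoopSl2 M := by
  let ε : ι → ℂ[T;T⁻¹] := fun i => Polynomial.toLaurent (Lagrange.basis S a i)
  have hroot : ∀ i ∈ S, Polynomial.toLaurent (X - Polynomial.C (a i)) * ε i ∈ annIdeal M :=
    fun i hi => by
      rw [← map_mul]
      exact Ideal.mem_of_dvd _ (map_dvd _ (prod_X_sub_C_dvd_X_sub_C_mul_basis a hi)) hS
  have hidem : ∀ i ∈ S, ε i * ε i - ε i ∈ annIdeal M := fun i hi => by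
    have h := sub_smul_mem_of_X_sub_C_mul_mem (hroot i hi) (Lagrange.basis S a i)
    rwa [Lagrange.eval_basis_self hinj hi, one_smul] at h
  have hone : 1 - ∑ i ∈ S, ε i ∈ annIdeal M := by
    rcases S.eq_empty_or_nonempty with rfl | hne
    · simpa using hS
    · rw [← map_sum, Lagrange.sum_basis hinj hne, map_one, sub_self]
      exact Submodule.zero_mem _
  have hsum : hOp M 1 = ∑ i ∈ S, hOp M (ε i) := by
    rw [loopOp_eq_of_sub_mem hone, map_sum]
  choose m hm using fun i => hΩ.exists_hOp_apply (ε i)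
  refine isIrreducible_of_primitive hΩ hgen (r := ∑ i ∈ S, m i) ?_ fun w hw => ?_
  · rw [hsum, LinearMap.sum_apply, Finset.sum_smul]
    exact Finset.sum_congr rfl fun i _ => hm i
  · rw [hsum, LinearMap.sum_apply, Finset.sum_smul]
    refine Finset.sum_congr rfl fun i hi => ?_
    choose χ hχ using exists_sub_smul_mem_of_X_sub_C_mul_mem (ha i hi) (hroot i hi)
    exact hOp_apply_of_primitive hΩ hgen hχ (hidem i hi) (hm i) (hw _)

section GeneratedRep

variable {V : Type*} [AddCommGroup V] [Module ℂ V] [LieRingModule LoopSl2 V]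

/-- The vector `Ω` as an element of the representation it generates. -/
def generator (Ω : V) : generatedRep Ω :=
  ⟨Ω, LieSubmodule.subset_lieSpan (Set.mem_singleton Ω)⟩

theorem lieSpan_generator (Ω : V) : LieSubmodule.lieSpan ℂ LoopSl2 {generator Ω} = ⊤ := by
  rw [eq_top_iff]
  have h : generatedRep Ω ≤
      (LieSubmodule.lieSpan ℂ LoopSl2 {generator Ω}).map (generatedRep Ω).incl := by
    refine LieSubmodule.lieSpan_le.mpr (Set.singleton_subset_iff.mpr ?_)
    exact LieSubmodule.mem_map_of_mem (LieSubmodule.subset_lieSpan (Set.mem_singleton _))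
  intro x _
  obtain ⟨y, hy, hyx⟩ := (LieSubmodule.mem_map _).mp (h x.2)
  rwa [← Subtype.ext hyx]

theorem IsHighestWeightVector.generator {Ω : V} (hΩ : IsHighestWeightVector Ω) :
    IsHighestWeightVector (generator Ω) where
  ne_zero h := hΩ.ne_zero (congrArg Subtype.val h)
  xPlus_lie k := Subtype.ext (hΩ.xPlus_lie k)
  hGen_lie k := (hΩ.hGen_lie k).imp fun _ hd => Subtype.ext hd

variable [LieModule ℂ LoopSl2 V]

theorem coe_loopOp_pow (Ω : V) (A : LieAlgebra.SpecialLinear.sl (Fin 2) ℂ) (g : ℂ[T;T⁻¹]) (n : ℕ)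
    (m : generatedRep Ω) :
    (((loopOp (generatedRep Ω) A g ^ n) m : generatedRep Ω) : V) = (loopOp V A g ^ n) m := by
  induction n with
  | zero => rfl
  | succ n ih =>
    rw [pow_succ', pow_succ', Module.End.mul_apply, Module.End.mul_apply, ← ih]
    rfl

theorem hOp_one_generator {Ω : V} (hΩ : IsHighestWeightVector Ω)
    [FiniteDimensional ℂ (generatedRep Ω)] :
    hOp (generatedRep Ω) 1 (generator Ω) = (weight Ω : ℂ) • generator Ω := by
  obtain ⟨d, hd⟩ := hΩ.generator.exists_hOp_apply 1
  obtain ⟨n, rfl⟩ := exists_nat_of_primitive (H := hOp (generatedRep Ω) 1)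
    (E := eOp (generatedRep Ω) 1) (F := fOp (generatedRep Ω) 1)
    (by rw [hOp_mul_eOp, one_mul]) (by rw [hOp_mul_fOp, one_mul]) (by rw [eOp_mul_fOp, one_mul])
    hΩ.generator.ne_zero (hΩ.generator.eOp_apply 1) hd
  have h : ⁅hGen 0, Ω⁆ = (n : ℂ) • Ω := congrArg Subtype.val hd
  rw [hd, weight_eq hΩ.ne_zero h]

theorem dividedPower_xMinus_weight_succ {Ω : V} (hΩ : IsHighestWeightVector Ω)
    [FiniteDimensional ℂ (generatedRep Ω)] :
    dividedPower V (xMinus 1) (weight Ω + 1) Ω = 0 := by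
  have h := pow_apply_eq_zero_of_primitive (H := hOp (generatedRep Ω) 1)
    (E := eOp (generatedRep Ω) (T (-1))) (F := fOp (generatedRep Ω) (T 1))
    (by rw [hOp_mul_eOp, one_mul]) (by rw [hOp_mul_fOp, one_mul])
    (by rw [eOp_mul_fOp, ← T_add, neg_add_cancel, T_zero])
    hΩ.generator.ne_zero (hΩ.generator.eOp_apply _) (hOp_one_generator hΩ)
  have h' := congrArg Subtype.val h
  rw [coe_loopOp_pow] at h'
  rw [dividedPower, LinearMap.smul_apply, toEnd_xMinus]
  exact (congrArg _ h').trans (smul_zero _)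

theorem garlandP_lam_weight {Ω : V} {a : Fin (weight Ω) → ℂ} (ha : IsEvaluationParameters Ω a) :
    garlandP (lam Ω) (weight Ω) =
      Polynomial.C ((-1) ^ weight Ω) * ∏ i, (X - Polynomial.C (a i)) := by
  refine Polynomial.eq_of_infinite_eval_eq _ _
    ((Set.finite_singleton (0 : ℂ)).infinite_compl.mono fun x hx => ?_)
  have hx : x ≠ 0 := hx
  have h := congrArg (Polynomial.eval x⁻¹) ha
  simp only [drinfeldPolynomial, Polynomial.eval_finsetSum, Polynomial.eval_mul, Polynomial.eval_C,
    Polynomial.eval_pow, Polynomial.eval_neg, Polynomial.eval_X, Polynomial.eval_prod,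
    Polynomial.eval_sub, Polynomial.eval_one] at h
  have hprod : ∏ i, (x - a i) = x ^ weight Ω * ∏ i, (1 - a i * x⁻¹) := by
    have hc : x ^ weight Ω = ∏ _i : Fin (weight Ω), x := by simp
    rw [hc, ← Finset.prod_mul_distrib]
    refine Finset.prod_congr rfl fun i _ => ?_
    field_simp
  rw [Set.mem_ofPred_eq, eval_garlandP _ _ hx, h, Polynomial.eval_mul, Polynomial.eval_C,
    Polynomial.eval_prod]
  simp only [Polynomial.eval_sub, Polynomial.eval_X, Polynomial.eval_C]
  rw [hprod, ← mul_assoc, ← mul_pow, neg_one_mul]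

theorem mem_annIdeal_of_isEvaluationParameters {Ω : V} (hΩ : IsHighestWeightVector Ω)
    [FiniteDimensional ℂ (generatedRep Ω)] {a : Fin (weight Ω) → ℂ}
    (ha : IsEvaluationParameters Ω a) :
    Polynomial.toLaurent (∏ i with a i ≠ 0, (X - Polynomial.C (a i))) ∈
      annIdeal (generatedRep Ω) := by
  have h := garland hΩ (weight Ω)
  rw [dividedPower_xMinus_weight_succ hΩ, map_zero, lowerMap_apply, garlandP_lam_weight ha] at h
  have h' := mem_annIdeal_of_fOp_eq_zero hΩ.generator (lieSpan_generator Ω) (Subtype.ext h.symm)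
  have hunit : IsUnit (T 1 * Polynomial.toLaurent (Polynomial.C ((-1 : ℂ) ^ weight Ω)) *
      Polynomial.toLaurent (∏ i with ¬ a i ≠ 0, (X - Polynomial.C (a i)))) := by
    refine ((isUnit_T 1).mul ?_).mul ?_
    · rw [Polynomial.toLaurent_C]
      exact ((isUnit_one.neg.pow _).map LaurentPolynomial.C)
    · rw [map_prod]
      refine IsUnit.prod_iff.mpr fun i hi => ?_
      have hi0 : a i = 0 := by simpa using hi
      rw [hi0, map_zero, sub_zero, Polynomial.toLaurent_X]
      exact isUnit_T 1
  rw [← Ideal.unit_mul_mem_iff_mem _ hunit]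
  rw [map_mul, ← Finset.prod_filter_mul_prod_filter_not Finset.univ (fun i => a i ≠ 0),
    map_mul] at h'
  convert h' using 1
  ring

end GeneratedRep

end Sl2Loop

end

theorem mainTheorem1 {V : Type*} [AddCommGroup V] [Module ℂ V]
    [LieRingModule Sl2Loop.LoopSl2 V] [LieModule ℂ Sl2Loop.LoopSl2 V]
    (Ω : V) (hΩ : Sl2Loop.IsHighestWeightVector Ω)
    (hfin : FiniteDimensional ℂ (Sl2Loop.generatedRep Ω))
    (a : Fin (Sl2Loop.weight Ω) → ℂ) (ha : Sl2Loop.IsEvaluationParameters Ω a)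
    (hdistinct : Function.Injective a) :
    LieModule.IsIrreducible ℂ Sl2Loop.LoopSl2 (Sl2Loop.generatedRep Ω) := by
  exact Sl2Loop.isIrreducible_of_prod_mem_annIdeal hΩ.generator (Sl2Loop.lieSpan_generator Ω)
    hdistinct.injOn (by simp) (Sl2Loop.mem_annIdeal_of_isEvaluationParameters hΩ ha)
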